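/- A \emph{scwol} (small category without loops) $X$ consists of a set $VX$ of vertices, a set $EX$ of edges, maps $i,t:EX\to VX$ and an associative product $(a,b)\mapsto ab\in EX$, defined for $i(a)=t(b)$, with $i(ab)=i(b)$, $t(ab)=t(a)$, and $i(a)\neq t(a)$ for every $a\in EX$. A morphism of scwols $f:X\to Y$ commutes with $i$, $t$ and the products and maps $\{a: i(a)=\sigma\}$ bijectively onto $\{a': i(a')=f(\sigma)\}$ for every $\sigma\in VX$. A \emph{complex of groups} $\mathbb X=((G_\sigma),(\psi_a),(g_{a,b}))$ over $X$ consists of groups $G_\sigma$ ($\sigma\in VX$), monomorphisms $\psi_a:G_{i(a)}\to G_{t(a)}$ ($a\in EX$) and elements $g_{a,b}\in G_{t(a)}$ (for $i(a)=t(b)$) such that $g_{a,b}\,\psi_{ab}(\cdot)\,g_{a,b}^{-1}=\psi_a\psi_b$ and $\psi_a(g_{b,c})g_{a,bc}=g_{a,b}g_{ab,c}$. It is \emph{developable} if it is isomorphic to the complex of groups associated to an action of a group on a scwol, where an action is assumed to satisfy $g\cdot i(a)\ne t(a)$, and $g\cdot a=a$ whenever $g\cdot i(a)=i(a)$. A \emph{morphism}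 $\phi:\mathbb X\to\mathbb Y$ over $f:X\to Y$ consists of homomorphisms $\phi_\sigma:G_\sigma\to G_{f(\sigma)}$ and elements $\phi(a)\in G_{f(t(a))}$ such that $\phi(a)\,\psi_{f(a)}(\phi_{i(a)}(\cdot))\,\phi(a)^{-1}=\phi_{t(a)}\psi_a$ and $\phi_{t(a)}(g_{a,b})\phi(ab)=\phi(a)\psi_{f(a)}(\phi(b))g_{f(a),f(b)}$; it is an isomorphism if $f$ and all $\phi_\sigma$ are isomorphisms. It is a \emph{covering} if $f$ is surjective, every $\phi_\sigma$ is injective, and for all $\sigma\in VX$ and $a'\in EY$ with $t(a')=f(\sigma)$ the map $$\coprod_{a\in f^{-1}(a'),\,t(a)=\sigma} G_\sigma/\psi_a(G_{i(a)})\to G_{f(\sigma)}/\psi_{a'}(G_{i(a')}),\qquad g\,\psi_a(G_{i(a)})\mapsto\phi_\sigma(g)\phi(a)\,\psi_{a'}(G_{i(a')})$$ is bijective. For $\sigma_0\in VX$ the group $\pi_1(\mathbb X,\sigma_0)$ consists of the homotopy classes of $\mathbb X$-loops $(g_0,e_1,g_1,\dots,e_k,g_k)$ at $\sigma_0$, where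 $(e_1,\dots,e_k)$ is an edge loop in $X$ at $\sigma_0$ (edges may be traversed in either direction), $g_0\in G_{\sigma_0}$, $g_j\in G_{t(e_j)}$, with multiplication induced by concatenation. Homotopy of $\mathbb X$-paths is the equivalence relation generated by replacing subpaths as follows: $(kg,a,h)\to(k,a,\psi_a(g)h)$; $(g,a^{-1},hk)\to(g\psi_a(h),a^{-1},k)$; $(g,a,\psi_a(h),a^{-1},k)\to(ghk)$; $(g,b^{-1},h,b,k)\to(g\psi_b(h)k)$; $(g,b,1,a,k)\to(g,ab,g_{a,b}^{-1}k)$; $(g,a^{-1},1,b^{-1},k)\to(gg_{a,b},(ab)^{-1},k)$. A morphism $\phi$ over $f$ induces a homomorphism $\phi_*:\pi_1(\mathbb X,\sigma_0)\to\pi_1(\mathbb Y,f(\sigma_0))$, given by the multiplicative extension of $(g)\mapsto(\phi_\sigma(g))$, $(1,a,1)\mapsto(1,f(a),\phi(a)^{-1})$, $(1,a^{-1},1)\mapsto(\phi(a),f(a)^{-1},1)$. \textbf{Statement.} Let $\mathbb X$ and $\mathbb Y$ be developable complexes of groups over connected scwols $X$ and $Y$, let $\phi:\mathbb X\to\mathbb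 Y$ be a covering over $f:X\to Y$, let $\sigma_0\in VX$, and let $\tau_0=f(\sigma_0)$. Then the induced homomorphism $\phi_*:\pi_1(\mathbb X,\sigma_0)\to\pi_1(\mathbb Y,\tau_0)$ is injective. The subgroup $\phi_*(\pi_1(\mathbb X,\sigma_0))\le\pi_1(\mathbb Y,\tau_0)$, consisting of all elements $\phi_*(x)$ with $x\in\pi_1(\mathbb X,\sigma_0)$, is called the \emph{characteristic subgroup} of the covering. -/

import Mathlib

universe u v w u₁ v₁ w₁ u₂ v₂ w₂ u₃ v₃ p q r p₁ q₁ r₁ p₂ q₂ r₂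

/-- A small category without loops (scwol).  The edges are given as a family: `Edge σ τ` is the set
of edges `a` with initial vertex `i(a) = σ` and terminal vertex `t(a) = τ`, so that the set of all
edges is the disjoint union `Scwol.E` of this family, and `comp a b` is the product `ab`, which is
defined exactly when `i(a) = t(b)`, and satisfies `i(ab) = i(b)`, `t(ab) = t(a)`. -/
structure Scwol where
  V : Type u
  Edge : V → V → Type v
  comp : ∀ {σ τ ρ : V}, Edge τ ρ → Edge σ τ → Edge σ ρ
  assoc : ∀ {σ τ ρ κ : V} (a : Edge ρ κ) (b : Edge τ ρ) (c : Edge σ τ),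
    comp (comp a b) c = comp a (comp b c)
  noLoops : ∀ σ : V, IsEmpty (Edge σ σ)

namespace Scwol

/-- The set of all edges of a scwol. -/
abbrev E (X : Scwol.{u, v}) : Type (max u v) := (σ : X.V) × (τ : X.V) × X.Edge σ τ

/-- The set of edges with initial vertex `σ`. -/
abbrev Out (X : Scwol.{u, v}) (σ : X.V) : Type (max u v) := (τ : X.V) × X.Edge σ τ

/-- The set of edges with terminal vertex `σ`. -/
abbrev In (X : Scwol.{u, v}) (σ : X.V) : Type (max u v) := (ρ : X.V) × X.Edge ρ σ

/-- Oriented edges from `σ` to `τ`: `pos a` is the edge `a : σ → τ` itself, and `neg a` is the formal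
inverse `a⁻¹` of an edge `a : τ → σ`. -/
inductive OEdge (X : Scwol.{u, v}) (σ τ : X.V) : Type v
  | pos (a : X.Edge σ τ) : OEdge X σ τ
  | neg (a : X.Edge τ σ) : OEdge X σ τ

/-- The involution on oriented edges. -/
def OEdge.inv {X : Scwol.{u, v}} {σ τ : X.V} : X.OEdge σ τ → X.OEdge τ σ
  | .pos a => .neg a
  | .neg a => .pos a

/-- A scwol is connected if any two vertices are joined by a finite path of oriented edges. -/
def Connected (X : Scwol.{u, v}) : Prop :=
  ∀ σ τ : X.V, Relation.ReflTransGen (fun α β => Nonempty (X.OEdge α β)) σ τ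

/-- A (non-degenerate) morphism of scwols. -/
@[ext]
structure Hom (X : Scwol.{u₁, v₁}) (Y : Scwol.{u₂, v₂}) where
  onV : X.V → Y.V
  onEdge : ∀ {σ τ : X.V}, X.Edge σ τ → Y.Edge (onV σ) (onV τ)
  map_comp : ∀ {σ τ ρ : X.V} (a : X.Edge τ ρ) (b : X.Edge σ τ),
    onEdge (X.comp a b) = Y.comp (onEdge a) (onEdge b)
  star_bijective : ∀ σ : X.V, Function.Bijective
    (fun e : X.Out σ => (⟨onV e.1, onEdge e.2⟩ : Y.Out (onV σ)))

namespace Hom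

variable {X : Scwol.{u₁, v₁}} {Y : Scwol.{u₂, v₂}} {Z : Scwol.{u₃, v₃}}

/-- The map that a morphism induces on the sets of all edges. -/
def onE (f : Hom X Y) (e : X.E) : Y.E := ⟨f.onV e.1, f.onV e.2.1, f.onEdge e.2.2⟩

/-- The map that a morphism induces from the edges terminating at `σ` to the edges terminating
at the image of `σ`. -/
def onIn (f : Hom X Y) {σ : X.V} (e : X.In σ) : Y.In (f.onV σ) := ⟨f.onV e.1, f.onEdge e.2⟩

/-- The identity morphism. -/
def id (X : Scwol.{u, v}) : Hom X X where
  onV := fun σ => σ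
  onEdge := fun a => a
  map_comp := fun _ _ => rfl
  star_bijective := fun _ => Function.bijective_id

/-- Composition of morphisms. -/
def comp (g : Hom Y Z) (f : Hom X Y) : Hom X Z where
  onV := fun σ => g.onV (f.onV σ)
  onEdge := fun a => g.onEdge (f.onEdge a)
  map_comp := fun a b => by rw [f.map_comp, g.map_comp]
  star_bijective := fun σ => (g.star_bijective (f.onV σ)).comp (f.star_bijective σ)

/-- A morphism of scwols is surjective if it is so on vertices and on edges. -/
def Surjective (f : Hom X Y) : Prop :=
  Function.Surjective f.onV ∧ Function.Surjective f.onE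

/-- A morphism of scwols is an isomorphism if it is bijective on vertices and on edges. -/
def IsIso (f : Hom X Y) : Prop :=
  Function.Bijective f.onV ∧ Function.Bijective f.onE

instance : Monoid (Hom X X) where
  mul := comp
  one := id X
  mul_assoc := fun _ _ _ => rfl
  one_mul := fun _ => rfl
  mul_one := fun _ => rfl

end Hom

/-- The group of automorphisms of a scwol. -/
abbrev Aut (X : Scwol.{u, v}) : Type (max u v) := (Hom X X)ˣ

/-- An action of a group on a scwol. -/
structure Action (Γ : Type p) [Group Γ] (W : Scwol.{q, r}) where
  toAut : Γ →* W.Aut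
  /-- No group element maps the initial vertex of an edge to its terminal vertex. -/
  ne_of_edge : ∀ (g : Γ) {σ τ : W.V}, W.Edge σ τ → (toAut g).val.onV σ ≠ τ
  /-- A group element that fixes the initial vertex of an edge fixes the edge. -/
  fix_edge : ∀ (g : Γ) {σ τ : W.V} (a : W.Edge σ τ), (toAut g).val.onV σ = σ →
    (toAut g).val.onE ⟨σ, τ, a⟩ = ⟨σ, τ, a⟩

end Scwol

/-- A complex of groups over a scwol `X`: local groups `G σ`, boundary monomorphisms `ψ a` and
twisting elements `tw a b`. -/
structure ComplexOfGroups (X : Scwol.{u, v}) where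
  G : X.V → Type w
  [grp : ∀ σ, Group (G σ)]
  ψ : ∀ {σ τ : X.V}, X.Edge σ τ → G σ →* G τ
  ψ_injective : ∀ {σ τ : X.V} (a : X.Edge σ τ), Function.Injective (ψ a)
  tw : ∀ {σ τ ρ : X.V}, X.Edge τ ρ → X.Edge σ τ → G ρ
  conj_tw : ∀ {σ τ ρ : X.V} (a : X.Edge τ ρ) (b : X.Edge σ τ) (g : G σ),
    tw a b * ψ (X.comp a b) g * (tw a b)⁻¹ = ψ a (ψ b g)
  cocycle : ∀ {σ τ ρ κ : X.V} (a : X.Edge ρ κ) (b : X.Edge τ ρ) (c : X.Edge σ τ),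
    ψ a (tw b c) * tw a (X.comp b c) = tw a b * tw (X.comp a b) c

attribute [instance] ComplexOfGroups.grp

namespace ComplexOfGroups

/-- A morphism of complexes of groups over the morphism of scwols `f`, with local homomorphisms
`loc σ` and edge elements `el a`. -/
structure Morphism {X : Scwol.{u₁, v₁}} {Y : Scwol.{u₂, v₂}}
    (𝕏 : ComplexOfGroups.{u₁, v₁, w₁} X) (𝕐 : ComplexOfGroups.{u₂, v₂, w₂} Y) where
  f : Scwol.Hom X Y
  loc : ∀ σ : X.V, 𝕏.G σ →* 𝕐.G (f.onV σ)
  el : ∀ {σ τ : X.V}, X.Edge σ τ → 𝕐.G (f.onV τ)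
  conj_el : ∀ {σ τ : X.V} (a : X.Edge σ τ) (g : 𝕏.G σ),
    el a * 𝕐.ψ (f.onEdge a) (loc σ g) * (el a)⁻¹ = loc τ (𝕏.ψ a g)
  el_comp : ∀ {σ τ ρ : X.V} (a : X.Edge τ ρ) (b : X.Edge σ τ),
    loc ρ (𝕏.tw a b) * el (X.comp a b) =
      el a * 𝕐.ψ (f.onEdge a) (el b) * 𝕐.tw (f.onEdge a) (f.onEdge b)

/-! ### Developability -/

/-- The stabilizer of a vertex under an action on a scwol. -/
def stab {Γ : Type p} [Group Γ] {W : Scwol.{q, r}} (A : Scwol.Action Γ W) (σ : W.V) :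
    Subgroup Γ where
  carrier := {g | (A.toAut g).val.onV σ = σ}
  one_mem' := by
    show (A.toAut 1).val.onV σ = σ
    rw [map_one]; rfl
  mul_mem' := by
    intro g h hg hh
    show (A.toAut (g * h)).val.onV σ = σ
    rw [map_mul]
    show (A.toAut g).val.onV ((A.toAut h).val.onV σ) = σ
    rw [show (A.toAut h).val.onV σ = σ from hh]; exact hg
  inv_mem' := by
    intro g hg
    show (A.toAut g⁻¹).val.onV σ = σ
    have h1 : (A.toAut (g⁻¹ * g)).val.onV σ = σ := by
      rw [inv_mul_cancel, map_one]; rfl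
    rw [map_mul] at h1
    have h2 : (A.toAut g⁻¹).val.onV ((A.toAut g).val.onV σ) = σ := h1
    rwa [show (A.toAut g).val.onV σ = σ from hg] at h2

/-- The choices needed to form the complex of groups associated to an action of `Γ` on the scwol
`W` with quotient scwol `X`: the quotient morphism `proj`, whose fibres are exactly the
`Γ`-orbits, a representative `rep σ` of each vertex `σ` of `X`, for each edge `a` of `X` the (unique)
lift of `a` that starts at the representative of `i(a)`, and an element `h a` of `Γ` that maps the
terminal vertex of this lift to the representative of `t(a)`. -/
structure QuotientData {Γ : Type p} [Group Γ] {W : Scwol.{q, r}} (A : Scwol.Action Γ W)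
    (X : Scwol.{u, v}) where
  proj : Scwol.Hom W X
  proj_surjective : proj.Surjective
  proj_onV_eq_iff : ∀ σ τ : W.V,
    proj.onV σ = proj.onV τ ↔ ∃ g : Γ, (A.toAut g).val.onV σ = τ
  proj_onE_eq_iff : ∀ a b : W.E,
    proj.onE a = proj.onE b ↔ ∃ g : Γ, (A.toAut g).val.onE a = b
  rep : X.V → W.V
  proj_rep : ∀ σ : X.V, proj.onV (rep σ) = σ
  lift : ∀ {σ τ : X.V}, X.Edge σ τ → W.Out (rep σ)
  proj_lift : ∀ {σ τ : X.V} (a : X.Edge σ τ), proj.onE ⟨rep σ, lift a⟩ = ⟨σ, τ, a⟩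
  h : ∀ {σ τ : X.V}, X.Edge σ τ → Γ
  h_lift : ∀ {σ τ : X.V} (a : X.Edge σ τ), (A.toAut (h a)).val.onV (lift a).1 = rep τ

namespace QuotientData

variable {Γ : Type p} [Group Γ] {W : Scwol.{q, r}} {A : Scwol.Action Γ W} {X : Scwol.{u, v}}

theorem act_mul (A : Scwol.Action Γ W) (g h : Γ) (σ : W.V) :
    (A.toAut (g * h)).val.onV σ = (A.toAut g).val.onV ((A.toAut h).val.onV σ) := by
  rw [map_mul]; rfl

theorem act_inv (A : Scwol.Action Γ W) (g : Γ) {σ τ : W.V} (h : (A.toAut g).val.onV σ = τ) :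
    (A.toAut g⁻¹).val.onV τ = σ := by
  rw [← h, ← act_mul, inv_mul_cancel, map_one]; rfl

theorem conj_mem (D : QuotientData A X) {σ τ : X.V} (a : X.Edge σ τ) {g : Γ}
    (hg : g ∈ stab A (D.rep σ)) : D.h a * g * (D.h a)⁻¹ ∈ stab A (D.rep τ) := by
  show (A.toAut (D.h a * g * (D.h a)⁻¹)).val.onV (D.rep τ) = D.rep τ
  have h1 := A.fix_edge g (D.lift a).2 hg
  have h2 : (A.toAut g).val.onV (D.lift a).1 = (D.lift a).1 :=
    congrArg (fun e : W.E => e.2.1) h1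
  rw [act_mul, act_mul, act_inv A _ (D.h_lift a), h2, D.h_lift a]

theorem lift_comp (D : QuotientData A X) {σ τ ρ : X.V} (a : X.Edge τ ρ) (b : X.Edge σ τ) :
    (D.lift (X.comp a b)).1 = (A.toAut (D.h b)⁻¹).val.onV (D.lift a).1 := by
  have hstart : (A.toAut (D.h b)⁻¹).val.onV (D.rep τ) = (D.lift b).1 :=
    act_inv A _ (D.h_lift b)
  set k := (D.h b)⁻¹ with hk
  -- transport the translated edge so that it starts at the end of the lift of `b`
  have key : ∀ (x : W.V) (_ : (A.toAut k).val.onV (D.rep τ) = x) (b' : W.Edge (D.rep σ) x)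
      (_ : D.proj.onE ⟨D.rep σ, x, b'⟩ = ⟨σ, τ, b⟩),
      (D.lift (X.comp a b)).1 = (A.toAut k).val.onV (D.lift a).1 := by
    intro x hx b' hb'
    subst hx
    have ha' : D.proj.onE ((A.toAut k).val.onE ⟨D.rep τ, D.lift a⟩) = ⟨τ, ρ, a⟩ := by
      rw [← D.proj_lift a]
      exact ((D.proj_onE_eq_iff _ _).2 ⟨k, rfl⟩).symm
    set a' := (A.toAut k).val.onEdge (D.lift a).2 with ha'def
    have hcomp : D.proj.onE ⟨D.rep σ, (A.toAut k).val.onV (D.lift a).1, W.comp a' b'⟩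
        = ⟨σ, ρ, X.comp a b⟩ := by
      have e1 : D.proj.onE ⟨D.rep σ, (A.toAut k).val.onV (D.lift a).1, W.comp a' b'⟩
        = (⟨D.proj.onV (D.rep σ), D.proj.onV ((A.toAut k).val.onV (D.lift a).1),
            X.comp (D.proj.onEdge a') (D.proj.onEdge b')⟩ : X.E) := by
        unfold Scwol.Hom.onE
        simp only [D.proj.map_comp]
      rw [e1]
      have gen : ∀ (s t r : X.V) (y : X.Edge s t) (z : X.Edge t r),
          (⟨s, t, y⟩ : X.E) = ⟨σ, τ, b⟩ → (⟨t, r, z⟩ : X.E) = ⟨τ, ρ, a⟩ →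
          (⟨s, r, X.comp z y⟩ : X.E) = ⟨σ, ρ, X.comp a b⟩ := by
        intro s t r y z h1 h2
        cases h1
        cases h2
        rfl
      exact gen _ _ _ _ _ hb' ha'
    have hl := D.proj_lift (X.comp a b)
    have heq := hl.trans hcomp.symm
    have hout : (⟨D.proj.onV (D.lift (X.comp a b)).1, D.proj.onEdge (D.lift (X.comp a b)).2⟩ :
        X.Out (D.proj.onV (D.rep σ))) =
        ⟨D.proj.onV ((A.toAut k).val.onV (D.lift a).1), D.proj.onEdge (W.comp a' b')⟩ :=
      eq_of_heq (Sigma.mk.inj_iff.1 heq).2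
    have := (D.proj.star_bijective (D.rep σ)).1
      (a₁ := D.lift (X.comp a b)) (a₂ := ⟨_, W.comp a' b'⟩) hout
    rw [this]
  exact key _ hstart (D.lift b).2 (D.proj_lift b)

theorem tw_mem (D : QuotientData A X) {σ τ ρ : X.V} (a : X.Edge τ ρ) (b : X.Edge σ τ) :
    D.h a * D.h b * (D.h (X.comp a b))⁻¹ ∈ stab A (D.rep ρ) := by
  show (A.toAut _).val.onV (D.rep ρ) = D.rep ρ
  rw [act_mul, act_mul, act_inv A _ (D.h_lift (X.comp a b)), D.lift_comp a b, ← act_mul A (D.h b),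
    mul_inv_cancel, map_one]
  exact D.h_lift a

/-- The complex of groups over `X` associated to an action with quotient `X`: the local groups are
the stabilizers of the representatives, `ψ a` is conjugation by `h a`, and the twisting elements are
`h a * h b * (h (ab))⁻¹`. -/
def assocComplex (D : QuotientData A X) : ComplexOfGroups.{u, v, p} X where
  G := fun σ => stab A (D.rep σ)
  ψ := fun {σ τ} a =>
    { toFun := fun g => ⟨D.h a * g.1 * (D.h a)⁻¹, D.conj_mem a g.2⟩
      map_one' := by ext; simp
      map_mul' := by intro g g'; ext; simp [mul_assoc] }
  ψ_injective := by
    intro σ τ a g g' hgg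
    have h1 : D.h a * g.1 * (D.h a)⁻¹ = D.h a * g'.1 * (D.h a)⁻¹ := congrArg Subtype.val hgg
    ext
    simpa using h1
  tw := fun a b => ⟨D.h a * D.h b * (D.h (X.comp a b))⁻¹, D.tw_mem a b⟩
  conj_tw := by intro σ τ ρ a b g; ext; simp [mul_assoc]
  cocycle := by intro σ τ ρ κ a b c; ext; simp [mul_assoc, X.assoc]

end QuotientData

/-- An isomorphism of complexes of groups is a morphism over an isomorphism of scwols all of whose
local homomorphisms are isomorphisms. -/
def Morphism.IsIso {X : Scwol.{u₁, v₁}} {Y : Scwol.{u₂, v₂}}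
    {𝕏 : ComplexOfGroups.{u₁, v₁, w₁} X} {𝕐 : ComplexOfGroups.{u₂, v₂, w₂} Y}
    (φ : Morphism 𝕏 𝕐) : Prop :=
  φ.f.IsIso ∧ ∀ σ : X.V, Function.Bijective (φ.loc σ)

/-- A complex of groups is developable if it is isomorphic to the complex of groups associated to an
action of a group on a scwol (whose quotient scwol is then isomorphic to `X`, and may be taken to
be `X` itself). -/
def IsDevelopable {X : Scwol.{u, v}} (𝕏 : ComplexOfGroups.{u, v, w} X) : Prop :=
  ∃ (Γ : Type p) (_ : Group Γ) (W : Scwol.{q, r}) (A : Scwol.Action Γ W) (D : QuotientData A X)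
    (φ : Morphism 𝕏 D.assocComplex), φ.IsIso

/-! ### Coverings -/

namespace Morphism

variable {X : Scwol.{u₁, v₁}} {Y : Scwol.{u₂, v₂}}
  {𝕏 : ComplexOfGroups.{u₁, v₁, w₁} X} {𝕐 : ComplexOfGroups.{u₂, v₂, w₂} Y}

/-- For a vertex `σ` of `X` and an edge `a'` of `Y` terminating at `f(σ)`, the map
`g ψ_a(G_{i(a)}) ↦ φ_σ(g) φ(a) ψ_{a'}(G_{i(a')})` from the disjoint union of the coset spaces
`G_σ / ψ_a(G_{i(a)})`, taken over all edges `a` with `f(a) = a'` and `t(a) = σ`, to the coset space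
`G_{f(σ)} / ψ_{a'}(G_{i(a')})`. -/
def cosetMap (φ : Morphism 𝕏 𝕐) (σ : X.V) (a' : Y.In (φ.f.onV σ)) :
    ((a : {a : X.In σ // φ.f.onIn a = a'}) × (𝕏.G σ ⧸ (𝕏.ψ a.1.2).range)) →
      𝕐.G (φ.f.onV σ) ⧸ (𝕐.ψ a'.2).range :=
  fun x => Quotient.liftOn' x.2
    (fun g => QuotientGroup.mk (φ.loc σ g * φ.el x.1.1.2)) (by
      obtain ⟨⟨a, rfl⟩, y⟩ := x
      intro g g' hgg
      rw [QuotientGroup.leftRel_apply] at hgg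
      obtain ⟨k, hk⟩ := hgg
      refine QuotientGroup.eq.2 ⟨φ.loc _ k, ?_⟩
      have h1 := φ.conj_el a.2 k
      rw [hk, map_mul, map_inv] at h1
      show 𝕐.ψ (φ.f.onEdge a.2) (φ.loc a.1 k) = _
      have h2 : 𝕐.ψ (φ.f.onEdge a.2) (φ.loc a.1 k) =
          (φ.el a.2)⁻¹ * (φ.el a.2 * 𝕐.ψ (φ.f.onEdge a.2) (φ.loc a.1 k) * (φ.el a.2)⁻¹) *
            φ.el a.2 := by group
      rw [h2, h1]
      group)

/-- A covering of complexes of groups. -/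
structure IsCovering (φ : Morphism 𝕏 𝕐) : Prop where
  surjective : φ.f.Surjective
  loc_injective : ∀ σ : X.V, Function.Injective (φ.loc σ)
  coset_bijective : ∀ (σ : X.V) (a' : Y.In (φ.f.onV σ)), Function.Bijective (φ.cosetMap σ a')

end Morphism

/-! ### Paths, homotopy and the fundamental group -/

section Paths

variable {X : Scwol.{u, v}}

/-- `𝕏`-paths `(g₀, e₁, g₁, …, e_k, g_k)` from `σ` to `τ`; `nil g` is the path `(g)` without edges,
and `cons g e p` is `(g, e, p)`. -/
inductive XPath (𝕏 : ComplexOfGroups.{u, v, w} X) : X.V → X.V → Type (max u v w)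
  | nil {σ : X.V} (g : 𝕏.G σ) : XPath 𝕏 σ σ
  | cons {σ τ ρ : X.V} (g : 𝕏.G σ) (e : X.OEdge σ τ) (p : XPath 𝕏 τ ρ) : XPath 𝕏 σ ρ

namespace XPath

variable {𝕏 : ComplexOfGroups.{u, v, w} X}

/-- Multiply the first group element of a path by `h` from the left. -/
def lmul : ∀ {σ τ : X.V}, 𝕏.G σ → XPath 𝕏 σ τ → XPath 𝕏 σ τ
  | _, _, h, nil g => nil (h * g)
  | _, _, h, cons g e p => cons (h * g) e p

/-- Concatenation of paths. -/
def append : ∀ {σ τ ρ : X.V}, XPath 𝕏 σ τ → XPath 𝕏 τ ρ → XPath 𝕏 σ ρ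
  | _, _, _, nil g, s => lmul g s
  | _, _, _, cons g e p, s => cons g e (append p s)

/-- The inverse path `(g_k⁻¹, e_k⁻¹, …, g₁⁻¹, e₁⁻¹, g₀⁻¹)`. -/
def inv : ∀ {σ τ : X.V}, XPath 𝕏 σ τ → XPath 𝕏 τ σ
  | _, _, nil g => nil g⁻¹
  | _, _, cons g e p => append (inv p) (cons 1 e.inv (nil g⁻¹))

@[simp] theorem lmul_nil {σ : X.V} (h g : 𝕏.G σ) : lmul h (nil g) = nil (h * g) := rfl

@[simp] theorem lmul_cons {σ τ ρ : X.V} (h g : 𝕏.G σ) (e : X.OEdge σ τ) (p : XPath 𝕏 τ ρ) :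
    lmul h (cons g e p) = cons (h * g) e p := rfl

@[simp] theorem nil_append {σ τ : X.V} (g : 𝕏.G σ) (s : XPath 𝕏 σ τ) :
    append (nil g) s = lmul g s := rfl

@[simp] theorem cons_append {σ τ ρ κ : X.V} (g : 𝕏.G σ) (e : X.OEdge σ τ) (p : XPath 𝕏 τ ρ)
    (s : XPath 𝕏 ρ κ) : append (cons g e p) s = cons g e (append p s) := rfl

@[simp] theorem lmul_one {σ τ : X.V} (s : XPath 𝕏 σ τ) : lmul 1 s = s := by
  cases s <;> simp

theorem lmul_lmul {σ τ : X.V} (g h : 𝕏.G σ) (s : XPath 𝕏 σ τ) :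
    lmul g (lmul h s) = lmul (g * h) s := by
  cases s <;> simp [mul_assoc]

theorem lmul_append {σ τ ρ : X.V} (g : 𝕏.G σ) (s : XPath 𝕏 σ τ) (t : XPath 𝕏 τ ρ) :
    append (lmul g s) t = lmul g (append s t) := by
  cases s with
  | nil h => simp [lmul_lmul]
  | cons h e p => simp

theorem append_assoc {σ τ ρ κ : X.V} (s : XPath 𝕏 σ τ) (t : XPath 𝕏 τ ρ) (m : XPath 𝕏 ρ κ) :
    append (append s t) m = append s (append t m) := by
  induction s with
  | nil g => simp [lmul_append]
  | cons g e p ih => simp [ih]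

theorem append_nil_one {σ τ : X.V} (s : XPath 𝕏 σ τ) : append s (nil 1) = s := by
  induction s with
  | nil g => simp
  | cons g e p ih => simp [ih]

end XPath

open XPath

variable {𝕏 : ComplexOfGroups.{u, v, w} X}

/-- The elementary moves on the subpath to be replaced. -/
inductive BasicMove : ∀ {σ τ : X.V}, XPath 𝕏 σ τ → XPath 𝕏 σ τ → Prop
  | slidePos {σ τ : X.V} (a : X.Edge σ τ) (k g : 𝕏.G σ) (h : 𝕏.G τ) :
      BasicMove (cons (k * g) (.pos a) (nil h)) (cons k (.pos a) (nil (𝕏.ψ a g * h)))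
  | slideNeg {σ τ : X.V} (a : X.Edge σ τ) (g : 𝕏.G τ) (h k : 𝕏.G σ) :
      BasicMove (cons g (.neg a) (nil (h * k))) (cons (g * 𝕏.ψ a h) (.neg a) (nil k))
  | reducePos {σ τ : X.V} (a : X.Edge σ τ) (g h k : 𝕏.G σ) :
      BasicMove (cons g (.pos a) (cons (𝕏.ψ a h) (.neg a) (nil k))) (nil (g * h * k))
  | reduceNeg {σ τ : X.V} (b : X.Edge σ τ) (g k : 𝕏.G τ) (h : 𝕏.G σ) :
      BasicMove (cons g (.neg b) (cons h (.pos b) (nil k))) (nil (g * 𝕏.ψ b h * k))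
  | shortcutPos {σ τ ρ : X.V} (a : X.Edge τ ρ) (b : X.Edge σ τ) (g : 𝕏.G σ) (k : 𝕏.G ρ) :
      BasicMove (cons g (.pos b) (cons 1 (.pos a) (nil k)))
        (cons g (.pos (X.comp a b)) (nil ((𝕏.tw a b)⁻¹ * k)))
  | shortcutNeg {σ τ ρ : X.V} (a : X.Edge τ ρ) (b : X.Edge σ τ) (g : 𝕏.G ρ) (k : 𝕏.G σ) :
      BasicMove (cons g (.neg a) (cons 1 (.neg b) (nil k)))
        (cons (g * 𝕏.tw a b) (.neg (X.comp a b)) (nil k))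

/-- One elementary move applied to a subpath. -/
inductive ElemMove : ∀ {σ τ : X.V}, XPath 𝕏 σ τ → XPath 𝕏 σ τ → Prop
  | mk {σ α β τ : X.V} (s : XPath 𝕏 σ α) {m m' : XPath 𝕏 α β} (t : XPath 𝕏 β τ)
      (h : BasicMove m m') : ElemMove (append s (append m t)) (append s (append m' t))

/-- Homotopy of `𝕏`-paths: the equivalence relation generated by the elementary moves. -/
def Homotopic {σ τ : X.V} (s t : XPath 𝕏 σ τ) : Prop := Relation.EqvGen ElemMove s t

theorem Homotopic.of_move {σ τ : X.V} {s t : XPath 𝕏 σ τ} (h : BasicMove s t) :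
    Homotopic s t := by
  have := ElemMove.mk (nil 1) (nil 1) h
  rw [append_nil_one, append_nil_one] at this
  simp only [nil_append, lmul_one] at this
  exact .rel _ _ this

theorem Homotopic.trans {σ τ : X.V} {s t m : XPath 𝕏 σ τ} (h : Homotopic s t)
    (h' : Homotopic t m) : Homotopic s m := Relation.EqvGen.trans _ _ _ h h'

theorem Homotopic.append_left {σ τ ρ : X.V} (s : XPath 𝕏 σ τ) {t t' : XPath 𝕏 τ ρ}
    (h : Homotopic t t') : Homotopic (append s t) (append s t') := by
  induction h with
  | rel x y hxy =>
    cases hxy with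
    | mk s' t' hm =>
      refine .rel _ _ ?_
      rw [← append_assoc, ← append_assoc s s']
      exact ElemMove.mk (append s s') t' hm
  | refl x => exact .refl _
  | symm x y _ ih => exact Relation.EqvGen.symm _ _ ih
  | trans x y z _ _ ih1 ih2 => exact Homotopic.trans ih1 ih2

theorem Homotopic.append_right {σ τ ρ : X.V} {s s' : XPath 𝕏 σ τ} (t : XPath 𝕏 τ ρ)
    (h : Homotopic s s') : Homotopic (append s t) (append s' t) := by
  induction h with
  | rel x y hxy =>
    cases hxy with
    | mk s' t' hm =>
      refine .rel _ _ ?_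
      rw [append_assoc, append_assoc, append_assoc, append_assoc]
      exact ElemMove.mk s' (append t' t) hm
  | refl x => exact .refl _
  | symm x y _ ih => exact Relation.EqvGen.symm _ _ ih
  | trans x y z _ _ ih1 ih2 => exact Homotopic.trans ih1 ih2

theorem Homotopic.append_congr {σ τ ρ : X.V} {s s' : XPath 𝕏 σ τ} {t t' : XPath 𝕏 τ ρ}
    (hs : Homotopic s s') (ht : Homotopic t t') : Homotopic (append s t) (append s' t') :=
  Homotopic.trans (hs.append_right t) (ht.append_left s')

theorem homotopic_edge_inv {σ τ : X.V} (g k : 𝕏.G σ) (e : X.OEdge σ τ) :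
    Homotopic (cons g e (cons 1 e.inv (nil k))) (nil (g * k)) := by
  cases e with
  | pos a =>
    have := Homotopic.of_move (BasicMove.reducePos (𝕏 := 𝕏) a g 1 k)
    rwa [map_one, mul_one] at this
  | neg a =>
    have := Homotopic.of_move (BasicMove.reduceNeg (𝕏 := 𝕏) a g k 1)
    rwa [map_one, mul_one] at this

theorem homotopic_inv_edge {σ τ : X.V} (g k : 𝕏.G τ) (e : X.OEdge σ τ) :
    Homotopic (cons g e.inv (cons 1 e (nil k))) (nil (g * k)) := by
  cases e with
  | pos a => exact homotopic_edge_inv g k (.neg a)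
  | neg a => exact homotopic_edge_inv g k (.pos a)

theorem append_inv {σ τ : X.V} (s : XPath 𝕏 σ τ) : Homotopic (append s s.inv) (nil 1) := by
  induction s with
  | nil g =>
    simp only [XPath.inv, nil_append, lmul_nil, mul_inv_cancel]
    exact .refl _
  | @cons σ τ ρ g e p ih =>
    have h1 : append (cons g e p) (cons g e p).inv =
        append (cons g e (nil 1)) (append (append p p.inv) (cons 1 e.inv (nil g⁻¹))) := by
      simp [XPath.inv, append_assoc]
    rw [h1]
    refine Homotopic.trans ((ih.append_right _).append_left _) ?_
    have h2 := homotopic_edge_inv g g⁻¹ e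
    rw [mul_inv_cancel] at h2
    simpa only [cons_append, nil_append, lmul_one] using h2

theorem inv_append {σ τ : X.V} (s : XPath 𝕏 σ τ) : Homotopic (append s.inv s) (nil 1) := by
  induction s with
  | nil g =>
    simp only [XPath.inv, nil_append, lmul_nil, inv_mul_cancel]
    exact .refl _
  | @cons σ τ ρ g e p ih =>
    have h1 : append (cons g e p).inv (cons g e p) =
        append p.inv (append (cons 1 e.inv (cons 1 e (nil 1))) p) := by
      simp [XPath.inv, append_assoc]
    rw [h1]
    refine Homotopic.trans (((homotopic_inv_edge 1 1 e).append_right p).append_left _) ?_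
    rw [mul_one, nil_append, lmul_one]
    exact ih

theorem Homotopic.inv_congr {σ τ : X.V} {s t : XPath 𝕏 σ τ} (h : Homotopic s t) :
    Homotopic s.inv t.inv := by
  have h1 : Homotopic (append s.inv (append t t.inv)) s.inv := by
    have := (append_inv t).append_left s.inv
    rwa [append_nil_one] at this
  have h2 : Homotopic (append (append s.inv s) t.inv) t.inv := by
    have := (inv_append s).append_right t.inv
    rwa [nil_append, lmul_one] at this
  rw [← append_assoc] at h1
  exact Homotopic.trans (.symm _ _ h1)
    (Homotopic.trans ((Homotopic.append_left s.inv (.symm _ _ h)).append_right t.inv) h2)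

end Paths

/-- Homotopy as a setoid on the set of `𝕏`-paths from `σ` to `τ`. -/
def homotopySetoid {X : Scwol.{u, v}} (𝕏 : ComplexOfGroups.{u, v, w} X) (σ τ : X.V) :
    Setoid (XPath 𝕏 σ τ) :=
  ⟨Homotopic, ⟨fun s => .refl s, fun h => .symm _ _ h, fun h h' => Homotopic.trans h h'⟩⟩

/-- The fundamental group `π₁(𝕏, σ₀)`: homotopy classes of `𝕏`-loops at `σ₀`. -/
def FundGroup {X : Scwol.{u, v}} (𝕏 : ComplexOfGroups.{u, v, w} X) (σ₀ : X.V) :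
    Type (max u v w) :=
  Quotient (homotopySetoid 𝕏 σ₀ σ₀)

namespace FundGroup

variable {X : Scwol.{u, v}} {𝕏 : ComplexOfGroups.{u, v, w} X} {σ₀ : X.V}

/-- The homotopy class of a loop. -/
def mk (s : XPath 𝕏 σ₀ σ₀) : FundGroup 𝕏 σ₀ := Quotient.mk (homotopySetoid 𝕏 σ₀ σ₀) s

instance : Group (FundGroup 𝕏 σ₀) where
  mul := Quotient.map₂ XPath.append (fun _ _ hs _ _ ht => Homotopic.append_congr hs ht)
  one := mk (XPath.nil 1)
  inv := Quotient.map XPath.inv (fun _ _ h => Homotopic.inv_congr h)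
  mul_assoc := by
    rintro ⟨s⟩ ⟨t⟩ ⟨m⟩
    exact congrArg mk (XPath.append_assoc s t m)
  one_mul := by
    rintro ⟨s⟩
    exact congrArg mk (XPath.lmul_one s)
  mul_one := by
    rintro ⟨s⟩
    exact congrArg mk (XPath.append_nil_one s)
  inv_mul_cancel := by
    rintro ⟨s⟩
    exact Quotient.sound (inv_append s)

end FundGroup

/-! ### The induced homomorphism -/

namespace Morphism

open XPath

variable {X : Scwol.{u₁, v₁}} {Y : Scwol.{u₂, v₂}}
  {𝕏 : ComplexOfGroups.{u₁, v₁, w₁} X} {𝕐 : ComplexOfGroups.{u₂, v₂, w₂} Y}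

/-- The image of an oriented edge: `a ↦ (1, f(a), φ(a)⁻¹)` and `a⁻¹ ↦ (φ(a), f(a)⁻¹, 1)`. -/
def mapOEdge (φ : Morphism 𝕏 𝕐) {σ τ : X.V} :
    X.OEdge σ τ → XPath 𝕐 (φ.f.onV σ) (φ.f.onV τ)
  | .pos a => cons 1 (.pos (φ.f.onEdge a)) (nil (φ.el a)⁻¹)
  | .neg a => cons (φ.el a) (.neg (φ.f.onEdge a)) (nil 1)

/-- The map on paths induced by a morphism. -/
def mapPath (φ : Morphism 𝕏 𝕐) : ∀ {σ τ : X.V}, XPath 𝕏 σ τ → XPath 𝕐 (φ.f.onV σ) (φ.f.onV τ)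
  | σ, _, nil g => nil (φ.loc σ g)
  | σ, _, cons g e p => append (nil (φ.loc σ g)) (append (φ.mapOEdge e) (φ.mapPath p))

theorem mapPath_lmul (φ : Morphism 𝕏 𝕐) {σ τ : X.V} (g : 𝕏.G σ) (s : XPath 𝕏 σ τ) :
    φ.mapPath (lmul g s) = lmul (φ.loc σ g) (φ.mapPath s) := by
  cases s with
  | nil h => simp [mapPath]
  | cons h e p => simp [mapPath, lmul_lmul]

theorem mapPath_append (φ : Morphism 𝕏 𝕐) {σ τ ρ : X.V} (s : XPath 𝕏 σ τ) (t : XPath 𝕏 τ ρ) :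
    φ.mapPath (append s t) = append (φ.mapPath s) (φ.mapPath t) := by
  induction s with
  | nil g => simp [mapPath, mapPath_lmul]
  | cons g e p ih => simp [mapPath, ih, append_assoc, lmul_append]

theorem psi_loc (φ : Morphism 𝕏 𝕐) {σ τ : X.V} (a : X.Edge σ τ) (g : 𝕏.G σ) :
    𝕐.ψ (φ.f.onEdge a) (φ.loc σ g) = (φ.el a)⁻¹ * φ.loc τ (𝕏.ψ a g) * φ.el a := by
  rw [← φ.conj_el]; group

theorem mapPath_basicMove (φ : Morphism 𝕏 𝕐) {σ τ : X.V} {s t : XPath 𝕏 σ τ}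
    (h : BasicMove s t) : Homotopic (φ.mapPath s) (φ.mapPath t) := by
  cases h with
  | slidePos a k g h =>
    have := Homotopic.of_move (BasicMove.slidePos (φ.f.onEdge a) (φ.loc _ k) (φ.loc _ g)
      ((φ.el a)⁻¹ * φ.loc _ h))
    rw [psi_loc] at this
    simpa [mapPath, mapOEdge, mul_assoc] using this
  | slideNeg a g h k =>
    have := Homotopic.of_move (BasicMove.slideNeg (φ.f.onEdge a) (φ.loc _ g * φ.el a) (φ.loc _ h)
      (φ.loc _ k))
    rw [psi_loc] at this
    simpa [mapPath, mapOEdge, mul_assoc] using this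
  | reducePos a g h k =>
    have := Homotopic.of_move (BasicMove.reducePos (φ.f.onEdge a) (φ.loc _ g) (φ.loc _ h)
      (φ.loc _ k))
    rw [psi_loc] at this
    simpa [mapPath, mapOEdge, mul_assoc] using this
  | reduceNeg b g k h =>
    have := Homotopic.of_move (BasicMove.reduceNeg (φ.f.onEdge b) (φ.loc _ g * φ.el b)
      ((φ.el b)⁻¹ * φ.loc _ k) (φ.loc _ h))
    rw [psi_loc] at this
    simpa [mapPath, mapOEdge, mul_assoc] using this
  | shortcutPos a b g k =>
    have h1 := (Homotopic.of_move (BasicMove.slidePos (φ.f.onEdge a) 1 (φ.el b)⁻¹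
      ((φ.el a)⁻¹ * φ.loc _ k))).append_left (cons (φ.loc _ g) (.pos (φ.f.onEdge b)) (nil 1))
    have h2 := Homotopic.of_move (BasicMove.shortcutPos (φ.f.onEdge a) (φ.f.onEdge b)
      (φ.loc _ g) (𝕐.ψ (φ.f.onEdge a) (φ.el b)⁻¹ * ((φ.el a)⁻¹ * φ.loc _ k)))
    simp only [cons_append, nil_append, lmul_cons, one_mul] at h1
    have h3 := h1.trans h2
    have e1 : (𝕐.tw (φ.f.onEdge a) (φ.f.onEdge b))⁻¹ *
        (𝕐.ψ (φ.f.onEdge a) (φ.el b)⁻¹ * ((φ.el a)⁻¹ * φ.loc _ k)) =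
        (φ.el (X.comp a b))⁻¹ * (φ.loc _ ((𝕏.tw a b)⁻¹ * k)) := by
      have := congrArg (fun x => x⁻¹ * φ.loc _ k) (φ.el_comp a b)
      simp only [mul_inv_rev, mul_assoc] at this
      simp only [map_inv, map_mul, this]
    rw [e1] at h3
    simpa only [mapPath, mapOEdge, cons_append, nil_append, lmul_cons, lmul_nil, map_one, one_mul,
      mul_one, φ.f.map_comp] using h3
  | shortcutNeg a b g k =>
    have h1 := (Homotopic.of_move (BasicMove.slideNeg (φ.f.onEdge a) (φ.loc _ g * φ.el a)
      (φ.el b) 1)).append_right (cons 1 (.neg (φ.f.onEdge b)) (nil (φ.loc _ k)))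
    have h2 := Homotopic.of_move (BasicMove.shortcutNeg (φ.f.onEdge a) (φ.f.onEdge b)
      (φ.loc _ g * φ.el a * 𝕐.ψ (φ.f.onEdge a) (φ.el b)) (φ.loc _ k))
    simp only [cons_append, nil_append, lmul_cons, mul_one] at h1
    have h3 := h1.trans h2
    have e1 : φ.loc _ g * φ.el a * 𝕐.ψ (φ.f.onEdge a) (φ.el b) *
        𝕐.tw (φ.f.onEdge a) (φ.f.onEdge b) = φ.loc _ (g * 𝕏.tw a b) * φ.el (X.comp a b) := by
      have := congrArg (fun x => φ.loc _ g * x) (φ.el_comp a b)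
      simp only [map_mul, mul_assoc] at this ⊢
      exact this.symm
    rw [e1] at h3
    simpa only [mapPath, mapOEdge, cons_append, nil_append, lmul_cons, lmul_nil, map_one, one_mul,
      mul_one, φ.f.map_comp] using h3

theorem mapPath_homotopic (φ : Morphism 𝕏 𝕐) {σ τ : X.V} {s t : XPath 𝕏 σ τ}
    (h : Homotopic s t) : Homotopic (φ.mapPath s) (φ.mapPath t) := by
  induction h with
  | rel x y hxy =>
    cases hxy with
    | mk s' t' hm =>
      simp only [mapPath_append]
      exact ((φ.mapPath_basicMove hm).append_right _).append_left _
  | refl x => exact .refl _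
  | symm x y _ ih => exact Relation.EqvGen.symm _ _ ih
  | trans x y z _ _ ih1 ih2 => exact Homotopic.trans ih1 ih2

/-- The homomorphism `π₁(𝕏, σ₀) → π₁(𝕐, f(σ₀))` induced by a morphism over `f`. -/
def inducedHom (φ : Morphism 𝕏 𝕐) (σ₀ : X.V) :
    FundGroup 𝕏 σ₀ →* FundGroup 𝕐 (φ.f.onV σ₀) where
  toFun := Quotient.map φ.mapPath (fun _ _ h => φ.mapPath_homotopic h)
  map_one' := congrArg FundGroup.mk (by simp [mapPath])
  map_mul' := by
    rintro ⟨s⟩ ⟨t⟩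
    exact congrArg FundGroup.mk (φ.mapPath_append s t)

/-- The characteristic subgroup of a covering. -/
def charSubgroup (φ : Morphism 𝕏 𝕐) (_ : φ.IsCovering) (σ₀ : X.V) :
    Subgroup (FundGroup 𝕐 (φ.f.onV σ₀)) :=
  (φ.inducedHom σ₀).range

end Morphism

end ComplexOfGroups

/-! As in covering space theory, injectivity comes from a monodromy action. A pair `(x, y)`, with
`x` an `𝕏`-path from `σ₀` to `σ` and `y` in the local group of `𝕐` at `f(σ)`, stands for the
`𝕐`-path `φ(x) y`. The fibre over `τ` is the set of such pairs with `f(σ) = τ`, up to homotopy of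
`x` and the relation `(x g, y) ∼ (x, φ(g) y)`.

Local groups of `𝕐` act on fibres by right multiplication. An edge `a'` of `Y` acts through its
unique lift starting at `σ`, which exists because `f` is bijective on outgoing edges. To act by
`a'⁻¹` this map must be invertible, and that is what bijectivity of the coset maps provides
(`IsCovering.fibreMap_bijective`). The relations of `𝕐` then hold on the fibres
(`IsCovering.pathAction`), so transport depends only on homotopy classes
(`PathAction.transport_homotopic`).

Transporting the class of the trivial path along `φ(s)` gives the class of `s`
(`IsCovering.transport_mapPath`). If `φ(s)` is null-homotopic, then `(s, 1) ∼ (1, 1)`, so `s` is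
homotopic to some `(g)` with `φ(g) = 1`, and injectivity of the local homomorphism forces `g = 1`.
-/

namespace ComplexOfGroups

open XPath

/-! ### Actions of the path groupoid and homotopy invariance of transport -/

/-- A right action of the path groupoid of a complex of groups: sets with right actions of the local
groups, and bijections along the edges that are compatible with the boundary monomorphisms and the
twisting elements. -/
structure PathAction {Y : Scwol.{u, v}} (𝕐 : ComplexOfGroups.{u, v, w} Y) where
  S : Y.V → Type p
  act : ∀ {τ : Y.V}, S τ → 𝕐.G τ → S τ
  act_mul : ∀ {τ : Y.V} (s : S τ) (g h : 𝕐.G τ), act s (g * h) = act (act s g) h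
  along : ∀ {τ ρ : Y.V}, Y.Edge τ ρ → S τ ≃ S ρ
  along_act : ∀ {τ ρ : Y.V} (a : Y.Edge τ ρ) (s : S τ) (g : 𝕐.G τ),
    along a (act s g) = act (along a s) (𝕐.ψ a g)
  along_comp : ∀ {τ ρ κ : Y.V} (a : Y.Edge ρ κ) (b : Y.Edge τ ρ) (s : S τ),
    along (Y.comp a b) s = act (along a (along b s)) (𝕐.tw a b)
  act_one : ∀ {τ : Y.V} (s : S τ), act s 1 = s

namespace PathAction

variable {Y : Scwol.{u, v}} {𝕐 : ComplexOfGroups.{u, v, w} Y} (M : PathAction.{u, v, w, p} 𝕐)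

/-- Transport along an oriented edge. -/
def alongO {τ ρ : Y.V} : Y.OEdge τ ρ → M.S τ ≃ M.S ρ
  | .pos a => M.along a
  | .neg a => (M.along a).symm

/-- Transport along a path. -/
def transport : ∀ {τ ρ : Y.V}, XPath 𝕐 τ ρ → M.S τ → M.S ρ
  | _, _, nil g, s => M.act s g
  | _, _, cons g e p, s => transport p (M.alongO e (M.act s g))

theorem along_symm_act {τ ρ : Y.V} (a : Y.Edge τ ρ) (s : M.S ρ) (g : 𝕐.G τ) :
    (M.along a).symm (M.act s (𝕐.ψ a g)) = M.act ((M.along a).symm s) g := by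
  rw [Equiv.symm_apply_eq, M.along_act, Equiv.apply_symm_apply]

theorem transport_lmul {τ ρ : Y.V} (g : 𝕐.G τ) (p : XPath 𝕐 τ ρ) (s : M.S τ) :
    M.transport (lmul g p) s = M.transport p (M.act s g) := by
  cases p <;> simp [transport, M.act_mul]

theorem transport_append {τ ρ κ : Y.V} (p : XPath 𝕐 τ ρ) (q : XPath 𝕐 ρ κ) (s : M.S τ) :
    M.transport (append p q) s = M.transport q (M.transport p s) := by
  induction p with
  | nil g => exact M.transport_lmul g q s
  | cons g e p ih => exact ih q _

/-- Each kind of move is covered by one axiom: slides by `along_act` and its inverse form,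
reductions by the same together with invertibility of `along`, shortcuts by `along_comp`. -/
theorem transport_basicMove {τ ρ : Y.V} {p q : XPath 𝕐 τ ρ} (h : BasicMove p q) (s : M.S τ) :
    M.transport p s = M.transport q s := by
  cases h with
  | slidePos a k g h => simp [transport, alongO, M.act_mul, M.along_act]
  | slideNeg a g h k => simp [transport, alongO, M.act_mul, M.along_symm_act]
  | reducePos a g h k => simp [transport, alongO, M.act_mul, M.along_symm_act]
  | reduceNeg b g k h => simp [transport, alongO, M.act_mul, M.along_act]
  | shortcutPos a b g k =>
    simp only [transport, alongO, M.along_comp, M.act_one]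
    rw [← M.act_mul, mul_inv_cancel_left]
  | shortcutNeg a b g k =>
    simp only [transport, alongO, M.act_one]
    congr 1
    rw [Equiv.eq_symm_apply, M.along_comp, M.act_mul]
    simp

theorem transport_homotopic {τ ρ : Y.V} {p q : XPath 𝕐 τ ρ} (h : Homotopic p q) :
    M.transport p = M.transport q := by
  induction h with
  | rel x y hxy =>
    cases hxy with
    | mk s' t' hm =>
      funext s
      simp only [transport_append, M.transport_basicMove hm]
  | refl x => rfl
  | symm x y _ ih => exact ih.symm
  | trans x y z _ _ ih1 ih2 => exact ih1.trans ih2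

end PathAction

theorem Homotopic.symm {X : Scwol.{u, v}} {𝕏 : ComplexOfGroups.{u, v, w} X} {σ τ : X.V}
    {s t : XPath 𝕏 σ τ} (h : Homotopic s t) : Homotopic t s :=
  Relation.EqvGen.symm _ _ h

theorem Homotopic.append_right_cancel {X : Scwol.{u, v}} {𝕏 : ComplexOfGroups.{u, v, w} X}
    {σ τ ρ : X.V} {s t : XPath 𝕏 σ τ} (m : XPath 𝕏 τ ρ)
    (h : Homotopic (append s m) (append t m)) : Homotopic s t := by
  have key : ∀ r : XPath 𝕏 σ τ, Homotopic (append (append r m) m.inv) r := fun r => by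
    have := (append_inv m).append_left r
    rwa [append_nil_one, ← append_assoc] at this
  exact .trans (key s).symm (.trans (h.append_right m.inv) (key t))

namespace Morphism

variable {X : Scwol.{u₁, v₁}} {Y : Scwol.{u₂, v₂}}
  {𝕏 : ComplexOfGroups.{u₁, v₁, w₁} X} {𝕐 : ComplexOfGroups.{u₂, v₂, w₂} Y}

/-! ### Points of the fibres and the relation between them -/

/-- A path in the source from `σ₀` to a vertex over `τ`, followed by an element of the local group
at `τ` in the target. -/
structure PathOver (φ : Morphism 𝕏 𝕐) (σ₀ : X.V) (τ : Y.V) where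
  base : X.V
  path : XPath 𝕏 σ₀ base
  base_eq : φ.f.onV base = τ
  elt : 𝕐.G τ

/-- The local homomorphism at `σ`, with values in the local group at `τ = f(σ)`. -/
def locOver (φ : Morphism 𝕏 𝕐) {σ : X.V} {τ : Y.V} (h : φ.f.onV σ = τ) : 𝕏.G σ →* 𝕐.G τ :=
  h ▸ φ.loc σ

namespace PathOver

variable {φ : Morphism 𝕏 𝕐} {σ₀ : X.V}

/-- `(x, y)` and `(x', y')` are equivalent if `x ∼ x' g` and `y' = φ(g) y` for some `g`. -/
def Rel {τ : Y.V} (p q : PathOver φ σ₀ τ) : Prop :=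
  ∃ (h : p.base = q.base) (g : 𝕏.G q.base),
    Homotopic (h ▸ p.path) (append q.path (nil g)) ∧ q.elt = φ.locOver q.base_eq g * p.elt

theorem rel_mk {σ : X.V} {τ : Y.V} {x x' : XPath 𝕏 σ₀ σ} {h h' : φ.f.onV σ = τ} {y y' : 𝕐.G τ}
    (g : 𝕏.G σ) (hx : Homotopic x (append x' (nil g))) (hy : y' = φ.locOver h g * y) :
    Rel (φ := φ) ⟨σ, x, h, y⟩ ⟨σ, x', h', y'⟩ :=
  ⟨rfl, g, hx, hy⟩

/-- Removes the transport along the equality of base vertices, so that later arguments work over one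
vertex `σ`. -/
theorem Rel.cases {τ : Y.V} {p q : PathOver φ σ₀ τ} (h : Rel p q) :
    ∃ (σ : X.V) (hσ : φ.f.onV σ = τ) (x x' : XPath 𝕏 σ₀ σ) (g : 𝕏.G σ) (y : 𝕐.G τ),
      Homotopic x (append x' (nil g)) ∧ p = ⟨σ, x, hσ, y⟩ ∧
        q = ⟨σ, x', hσ, φ.locOver hσ g * y⟩ := by
  obtain ⟨σ, x, hσ, y⟩ := p
  obtain ⟨σ', x', hσ', y'⟩ := q
  obtain ⟨h, g, hx, hy⟩ := h
  dsimp only at h hx hy g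
  subst h
  replace hy : y' = φ.locOver hσ g * y := hy
  subst hy
  exact ⟨_, hσ, x, x', g, y, hx, rfl, rfl⟩

theorem rel_equivalence (τ : Y.V) : Equivalence (Rel (φ := φ) (σ₀ := σ₀) (τ := τ)) where
  refl p := rel_mk 1 (by rw [append_nil_one]; exact .refl _) (by simp)
  symm := by
    intro p q h
    obtain ⟨σ, hσ, x, x', g, y, hx, rfl, rfl⟩ := h.cases
    refine rel_mk g⁻¹ ?_ (by simp)
    have := hx.append_right (nil g⁻¹)
    rw [append_assoc, nil_append, lmul_nil, mul_inv_cancel, append_nil_one] at this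
    exact this.symm
  trans := by
    intro p q r h h'
    obtain ⟨σ, hσ, x, x', g, y, hx, rfl, rfl⟩ := h.cases
    obtain ⟨σ', x'', hσ', y''⟩ := r
    obtain ⟨e, g', hx', hy'⟩ := h'
    dsimp only at e hx' hy' g'
    subst e
    replace hy' : y'' = φ.locOver hσ g' * (φ.locOver hσ g * y) := hy'
    subst hy'
    refine rel_mk (g' * g) (hx.trans ?_) (by simp [mul_assoc])
    have := hx'.append_right (nil g)
    rwa [append_assoc, nil_append, lmul_nil] at this

/-- Right multiplication by elements of the local group of the target. -/
def act {τ : Y.V} (p : PathOver φ σ₀ τ) (k : 𝕐.G τ) : PathOver φ σ₀ τ :=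
  ⟨p.base, p.path, p.base_eq, p.elt * k⟩

theorem act_rel {τ : Y.V} {p q : PathOver φ σ₀ τ} (h : Rel p q) (k : 𝕐.G τ) :
    Rel (p.act k) (q.act k) := by
  obtain ⟨σ, hσ, x, x', g, y, hx, rfl, rfl⟩ := h.cases
  exact rel_mk g hx (mul_assoc _ _ _)

instance setoid (τ : Y.V) : Setoid (PathOver φ σ₀ τ) := ⟨Rel, rel_equivalence τ⟩

/-- Extension along an edge of the source. -/
def extend {σ σ' : X.V} (x : XPath 𝕏 σ₀ σ) (y : 𝕐.G (φ.f.onV σ)) (a : X.Edge σ σ') :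
    PathOver φ σ₀ (φ.f.onV σ') :=
  -- The image of `a` in `𝕐` is `f(a) φ(a)⁻¹`, so `φ(x) y f(a) ∼ φ(x) f(a) ψ(y) ∼ φ(x a) φ(a) ψ(y)`,
  -- with `ψ` the boundary map of `f(a)`.
  ⟨σ', append x (cons 1 (.pos a) (nil 1)), rfl, φ.el a * 𝕐.ψ (φ.f.onEdge a) y⟩

/-- The edge of the source that starts at `σ` and lies over an edge starting at `f(σ)`. -/
noncomputable def liftOut (φ : Morphism 𝕏 𝕐) (σ : X.V) : Y.Out (φ.f.onV σ) ≃ X.Out σ :=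
  (Equiv.ofBijective _ (φ.f.star_bijective σ)).symm

/-- Extension along an edge of the target. -/
noncomputable def push {τ ρ : Y.V} (a' : Y.Edge τ ρ) : PathOver φ σ₀ τ → PathOver φ σ₀ ρ
  | ⟨σ, x, h, y⟩ => by
    subst h
    have e : φ.f.onV (liftOut φ σ ⟨ρ, a'⟩).1 = ρ :=
      congrArg Sigma.fst ((liftOut φ σ).symm_apply_apply ⟨ρ, a'⟩)
    exact e ▸ extend x y (liftOut φ σ ⟨ρ, a'⟩).2

/-- The cast in `push` disappears on edges of the form `f(a)`. Together with `exists_lift_out` this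
lets any single edge out of `f(σ)` be replaced by such an image. -/
theorem push_mk {σ σ' : X.V} (x : XPath 𝕏 σ₀ σ) (y : 𝕐.G (φ.f.onV σ)) (a : X.Edge σ σ') :
    push (φ.f.onEdge a) ⟨σ, x, rfl, y⟩ = extend x y a := by
  have key : ∀ (e : X.Out σ) (_ : e = ⟨σ', a⟩) (h : φ.f.onV e.1 = φ.f.onV σ'),
      (h ▸ extend x y e.2 : PathOver φ σ₀ (φ.f.onV σ')) = extend x y a := by
    rintro _ rfl h
    rfl
  exact key _ ((liftOut φ σ).apply_symm_apply ⟨σ', a⟩) _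

theorem exists_lift_out (φ : Morphism 𝕏 𝕐) {σ : X.V} {ρ : Y.V} (a' : Y.Edge (φ.f.onV σ) ρ) :
    ∃ (σ' : X.V) (a : X.Edge σ σ'),
      (⟨φ.f.onV σ', φ.f.onEdge a⟩ : Y.Out (φ.f.onV σ)) = ⟨ρ, a'⟩ := by
  obtain ⟨e, he⟩ := (φ.f.star_bijective σ).2 ⟨ρ, a'⟩
  exact ⟨e.1, e.2, he⟩

/-- For comparing two points over `τ` with different base vertices: `a'` cannot be written
definitionally as the image of both lifts, so the lift is recorded by an equality of incoming edges,
the form in which the coset maps index edges. -/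
theorem push_spec {τ ρ : Y.V} (a' : Y.Edge τ ρ) (p : PathOver φ σ₀ τ) :
    ∃ (σ' : X.V) (a : X.Edge p.base σ') (y : 𝕐.G (φ.f.onV p.base)) (h : φ.f.onV σ' = ρ),
      φ.f.onIn ⟨p.base, a⟩ = (⟨τ, h ▸ a'⟩ : Y.In (φ.f.onV σ')) ∧ HEq y p.elt ∧
        push a' p = ⟨σ', append p.path (cons 1 (.pos a) (nil 1)), h,
          h ▸ (φ.el a * 𝕐.ψ (φ.f.onEdge a) y)⟩ := by
  obtain ⟨σ, x, rfl, y⟩ := p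
  obtain ⟨σ', a, ha⟩ := exists_lift_out φ a'
  cases ha
  exact ⟨σ', a, y, rfl, rfl, HEq.rfl, push_mk _ _ _⟩

theorem homotopic_slide {σ σ' : X.V} (x : XPath 𝕏 σ₀ σ) (a : X.Edge σ σ') (g : 𝕏.G σ) :
    Homotopic (append (append x (nil g)) (cons 1 (.pos a) (nil 1)))
      (append (append x (cons 1 (.pos a) (nil 1))) (nil (𝕏.ψ a g))) := by
  have := (Homotopic.of_move (BasicMove.slidePos a 1 g 1)).append_left x
  simpa [append_assoc] using this

theorem push_rel {τ ρ : Y.V} (a' : Y.Edge τ ρ) {p q : PathOver φ σ₀ τ} (h : Rel p q) :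
    Rel (push a' p) (push a' q) := by
  obtain ⟨σ, rfl, x, x', g, y, hx, rfl, rfl⟩ := h.cases
  obtain ⟨σ', a, ha⟩ := exists_lift_out φ a'
  cases ha
  rw [push_mk, push_mk]
  refine rel_mk (𝕏.ψ a g) ((hx.append_right _).trans (homotopic_slide x' a g)) ?_
  -- The factor `φ(a)` in `extend` is what turns `ψ(φ(g))` into `φ(ψ(g))`.
  have := φ.psi_loc a g
  simp only [locOver, map_mul, this]
  group

end PathOver

/-! ### The covering condition makes edges act bijectively on fibres -/

/-- The set of equivalence classes of paths over `τ`. -/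
abbrev Fibre (φ : Morphism 𝕏 𝕐) (σ₀ : X.V) (τ : Y.V) : Type _ :=
  Quotient (PathOver.setoid (φ := φ) (σ₀ := σ₀) τ)

open PathOver

/-- Transport along an edge of the target. -/
noncomputable def fibreMap (φ : Morphism 𝕏 𝕐) (σ₀ : X.V) {τ ρ : Y.V} (a' : Y.Edge τ ρ) :
    φ.Fibre σ₀ τ → φ.Fibre σ₀ ρ :=
  Quotient.map (push a') (fun _ _ h => push_rel a' h)

theorem IsCovering.exists_factor {φ : Morphism 𝕏 𝕐} (hφ : φ.IsCovering) {σ : X.V}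
    (a' : Y.In (φ.f.onV σ)) (y : 𝕐.G (φ.f.onV σ)) :
    ∃ (a : X.In σ) (_ : φ.f.onIn a = a') (g : 𝕏.G σ) (k : 𝕐.G (φ.f.onV a.1)),
      y = φ.loc σ g * φ.el a.2 * 𝕐.ψ (φ.f.onEdge a.2) k := by
  obtain ⟨⟨⟨a, rfl⟩, c⟩, hc⟩ := (hφ.coset_bijective σ a').2 (QuotientGroup.mk y)
  induction c using QuotientGroup.induction_on with
  | H g =>
    obtain ⟨k, hk⟩ := QuotientGroup.eq.1 hc
    exact ⟨a, rfl, g, k, eq_mul_of_inv_mul_eq hk.symm⟩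

/-- The equation says that the coset of `g` at `a` and the trivial coset at `b` have the same image,
so injectivity of the coset map identifies them. -/
theorem IsCovering.eq_of_factor {φ : Morphism 𝕏 𝕐} (hφ : φ.IsCovering) {σ : X.V} {a b : X.In σ}
    (hab : φ.f.onIn a = φ.f.onIn b) (g : 𝕏.G σ) (k : 𝕐.G (φ.f.onV a.1)) (l : 𝕐.G (φ.f.onV b.1))
    (h : φ.el b.2 * 𝕐.ψ (φ.f.onEdge b.2) l =
      φ.loc σ g * (φ.el a.2 * 𝕐.ψ (φ.f.onEdge a.2) k)) :
    a = b ∧ ∃ k', 𝕏.ψ a.2 k' = g := by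
  have hk : 𝕐.ψ (φ.f.onEdge a.2) k ∈ (𝕐.ψ (φ.f.onIn b).2).range := by
    rw [← hab]
    exact ⟨k, rfl⟩
  have hinj := (hφ.coset_bijective σ (φ.f.onIn b)).1
    (a₁ := ⟨⟨a, hab⟩, QuotientGroup.mk g⟩) (a₂ := ⟨⟨b, rfl⟩, QuotientGroup.mk 1⟩) (by
      refine QuotientGroup.eq.2 ?_
      have e : (φ.loc σ g * φ.el a.2)⁻¹ * (φ.loc σ 1 * φ.el b.2) =
          𝕐.ψ (φ.f.onEdge a.2) k * (𝕐.ψ (φ.f.onEdge b.2) l)⁻¹ := by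
        rw [map_one, one_mul, eq_mul_inv_iff_mul_eq, mul_assoc, h]
        group
      rw [e]
      exact mul_mem hk (inv_mem ⟨l, rfl⟩))
  obtain rfl : a = b := congrArg (fun z => z.1.1) hinj
  refine ⟨rfl, ?_⟩
  have h2 := eq_of_heq (Sigma.mk.inj_iff.1 hinj).2
  obtain ⟨k', hk'⟩ := QuotientGroup.eq.1 h2.symm
  exact ⟨k', by simpa using hk'⟩

theorem IsCovering.fibreMap_bijective {φ : Morphism 𝕏 𝕐} (hφ : φ.IsCovering) (σ₀ : X.V)
    {τ ρ : Y.V} (a' : Y.Edge τ ρ) : Function.Bijective (φ.fibreMap σ₀ a') := by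
  constructor
  · rintro ⟨p⟩ ⟨q⟩ h
    obtain ⟨κ₁, a₁, y₁, h₁, ha₁, hy₁, hp⟩ := push_spec a' p
    obtain ⟨κ₂, a₂, y₂, h₂, ha₂, hy₂, hq⟩ := push_spec a' q
    have hrel : Rel (push a' p) (push a' q) := Quotient.exact h
    refine Quotient.sound (?_ : Rel p q)
    rw [hp, hq] at hrel
    subst h₁
    obtain ⟨hκ, g, hx, hy⟩ := hrel
    obtain ⟨σ₁, x₁, rfl, z₁⟩ := p
    obtain ⟨σ₂, x₂, hσ, z₂⟩ := q
    dsimp only at hκ g hx hy a₁ a₂ ha₁ ha₂ y₁ y₂ hy₁ hy₂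
    subst hκ
    -- The element `g` relating the two extended points comes from `k` at the start of the common
    -- lift, and this `k` relates the original points.
    obtain ⟨hab, k, rfl⟩ := hφ.eq_of_factor (a := ⟨σ₁, a₁⟩) (b := ⟨σ₂, a₂⟩)
      (ha₁.trans ha₂.symm) g y₁ y₂ hy
    cases hab
    obtain rfl := eq_of_heq hy₁
    obtain rfl := eq_of_heq hy₂
    refine rel_mk k ?_ ?_
    · exact Homotopic.append_right_cancel _ (hx.trans (homotopic_slide x₂ a₁ k).symm)
    · have e : φ.el a₁ * 𝕐.ψ (φ.f.onEdge a₁) y₂ =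
          φ.loc _ (𝕏.ψ a₁ k) * (φ.el a₁ * 𝕐.ψ (φ.f.onEdge a₁) y₁) := hy
      rw [← φ.conj_el] at e
      refine 𝕐.ψ_injective (φ.f.onEdge a₁) ?_
      simpa [mul_assoc, locOver] using e
  · rintro ⟨σ, x, rfl, y⟩
    obtain ⟨⟨σ', a⟩, ha, g, k, rfl⟩ := hφ.exists_factor ⟨τ, a'⟩ y
    cases ha
    -- With `y = φ(g) φ(a) ψ(k)`, going back along `a` after `x g` leaves `k`; pushing forward again
    -- cancels `a⁻¹ a` and gives `(x g, φ(a) ψ(k)) ∼ (x, y)`.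
    refine ⟨Quotient.mk _ ⟨σ', append x (cons g (.neg a) (nil 1)), rfl, k⟩, Quotient.sound ?_⟩
    rw [push_mk]
    refine rel_mk g ?_ (by simp [locOver, mul_assoc])
    have := (Homotopic.of_move (BasicMove.reduceNeg a g 1 1)).append_left x
    simpa [append_assoc] using this

/-! ### The monodromy action and transport along image paths -/

/-- The action of the path groupoid of the target of a covering on the fibres. -/
noncomputable def IsCovering.pathAction {φ : Morphism 𝕏 𝕐} (hφ : φ.IsCovering) (σ₀ : X.V) :
    PathAction.{u₂, v₂, w₂, max u₁ v₁ w₁ w₂} 𝕐 where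
  S := φ.Fibre σ₀
  act s g := Quotient.map (PathOver.act · g) (fun _ _ h => act_rel h g) s
  act_mul := by
    rintro τ ⟨s⟩ g h
    exact congrArg (Quotient.mk _) (by simp [PathOver.act, mul_assoc])
  act_one := by
    rintro τ ⟨s⟩
    exact congrArg (Quotient.mk _) (by simp [PathOver.act])
  along a' := Equiv.ofBijective _ (hφ.fibreMap_bijective σ₀ a')
  along_act := by
    rintro τ ρ a' ⟨σ, x, rfl, y⟩ g
    obtain ⟨σ', a, ha⟩ := exists_lift_out φ a'
    cases ha
    refine congrArg (Quotient.mk _) (?_ : push _ (PathOver.act _ _) = PathOver.act (push _ _) _)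
    rw [PathOver.act, push_mk, push_mk]
    simp [extend, PathOver.act, mul_assoc]
  along_comp := by
    rintro τ ρ κ a' b' ⟨σ, x, rfl, y⟩
    obtain ⟨σ', b, hb⟩ := exists_lift_out φ b'
    cases hb
    obtain ⟨σ'', a, ha⟩ := exists_lift_out φ a'
    cases ha
    rw [← φ.f.map_comp]
    refine Quotient.sound (?_ : Rel (push _ _) ((push _ (push _ _)).act _))
    rw [push_mk, push_mk, extend, extend, push_mk, extend, PathOver.act]
    refine rel_mk (𝕏.tw a b) ?_ ?_
    -- The last entry is the twisting element so that it cancels the inverse produced by the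
    -- shortcut.
    · have := (Homotopic.of_move (BasicMove.shortcutPos a b 1 (𝕏.tw a b))).append_left x
      exact Homotopic.symm (by simpa [append_assoc] using this)
    · have e := congrArg (· * 𝕐.ψ (Y.comp (φ.f.onEdge a) (φ.f.onEdge b)) y) (φ.el_comp a b)
      simp only [φ.f.map_comp, locOver, map_mul, mul_assoc, ← 𝕐.conj_tw] at e ⊢
      simp [e]

namespace IsCovering

variable {φ : Morphism 𝕏 𝕐} (hφ : φ.IsCovering) {σ₀ : X.V}

/-- The point of the fibre over `f(σ)` given by a path in the source. -/
def fibreMk {σ : X.V} (x : XPath 𝕏 σ₀ σ) : (hφ.pathAction σ₀).S (φ.f.onV σ) :=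
  Quotient.mk (PathOver.setoid _) ⟨σ, x, rfl, 1⟩

theorem fibreMk_homotopic {σ : X.V} {x x' : XPath 𝕏 σ₀ σ} (h : Homotopic x x') :
    hφ.fibreMk x = hφ.fibreMk x' :=
  Quotient.sound (rel_mk 1 (by rwa [append_nil_one]) (by simp))

theorem act_fibreMk {σ : X.V} (x : XPath 𝕏 σ₀ σ) (g : 𝕏.G σ) :
    (hφ.pathAction σ₀).act (hφ.fibreMk x) (φ.loc σ g) = hφ.fibreMk (append x (nil g)) :=
  Eq.symm (Quotient.sound (rel_mk g (.refl _) (by simp [locOver])))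

/-- The surplus `φ(a)` is cancelled by the factor `φ(a)⁻¹` in the image of `a`, which yields
`transport_mapOEdge`. -/
theorem along_fibreMk {σ τ : X.V} (x : XPath 𝕏 σ₀ σ) (a : X.Edge σ τ) :
    (hφ.pathAction σ₀).along (φ.f.onEdge a) (hφ.fibreMk x) =
      (hφ.pathAction σ₀).act (hφ.fibreMk (append x (cons 1 (.pos a) (nil 1)))) (φ.el a) :=
  congrArg (Quotient.mk _) (by
    show push _ _ = PathOver.act _ _
    rw [push_mk]
    simp [extend, PathOver.act])

theorem transport_mapOEdge {σ τ : X.V} (x : XPath 𝕏 σ₀ σ) (e : X.OEdge σ τ) :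
    (hφ.pathAction σ₀).transport (φ.mapOEdge e) (hφ.fibreMk x) =
      hφ.fibreMk (append x (cons 1 e (nil 1))) := by
  cases e with
  | pos a =>
    simp only [mapOEdge, PathAction.transport, PathAction.alongO, PathAction.act_one]
    rw [along_fibreMk, ← PathAction.act_mul, mul_inv_cancel, PathAction.act_one]
  | neg a =>
    simp only [mapOEdge, PathAction.transport, PathAction.alongO, PathAction.act_one]
    rw [Equiv.symm_apply_eq, along_fibreMk]
    congr 1
    refine fibreMk_homotopic hφ (Homotopic.symm ?_)
    have := (homotopic_edge_inv 1 1 (.neg a)).append_left x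
    rw [mul_one, append_nil_one] at this
    simpa [append_assoc, Scwol.OEdge.inv] using this

theorem transport_mapPath {σ τ : X.V} (x : XPath 𝕏 σ₀ σ) (s : XPath 𝕏 σ τ) :
    (hφ.pathAction σ₀).transport (φ.mapPath s) (hφ.fibreMk x) = hφ.fibreMk (append x s) := by
  induction s with
  | nil g => exact hφ.act_fibreMk x g
  | cons g e p ih =>
    simp only [mapPath, PathAction.transport_append, PathAction.transport]
    rw [act_fibreMk, transport_mapOEdge, ih]
    simp [append_assoc]

end IsCovering

/-! ### Injectivity of the induced homomorphism -/

theorem IsCovering.inducedHom_injective {φ : Morphism 𝕏 𝕐} (hφ : φ.IsCovering) (σ₀ : X.V) :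
    Function.Injective (φ.inducedHom σ₀) := by
  rw [injective_iff_map_eq_one]
  rintro ⟨s⟩ hs
  have hs' : Homotopic (φ.mapPath s) (nil 1) := Quotient.exact hs
  have h := congrFun ((hφ.pathAction σ₀).transport_homotopic hs')
    (hφ.fibreMk (nil 1))
  rw [hφ.transport_mapPath, nil_append, lmul_one] at h
  have h1 := h.trans ((hφ.pathAction σ₀).act_one _)
  obtain ⟨_, g, hx, hy⟩ := Quotient.exact h1
  -- Both points have second entry `1`, so `hy` reduces to `φ(g) = 1`.
  have hg : g = 1 := hφ.loc_injective σ₀ (by simpa [locOver] using hy.symm)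
  subst hg
  have hs1 : Homotopic s (nil 1) := by simpa using hx
  exact Quotient.sound hs1

end Morphism

end ComplexOfGroups

theorem mainTheorem9 {X : Scwol.{u₁, v₁}} {Y : Scwol.{u₂, v₂}}
    (𝕏 : ComplexOfGroups.{u₁, v₁, w₁} X) (𝕐 : ComplexOfGroups.{u₂, v₂, w₂} Y)
    (hX : X.Connected) (hY : Y.Connected)
    (h𝕏 : ComplexOfGroups.IsDevelopable.{u₁, v₁, w₁, p₁, q₁, r₁} 𝕏)
    (h𝕐 : ComplexOfGroups.IsDevelopable.{u₂, v₂, w₂, p₂, q₂, r₂} 𝕐)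
    (φ : ComplexOfGroups.Morphism 𝕏 𝕐) (hφ : φ.IsCovering) (σ₀ : X.V) :
    Function.Injective (φ.inducedHom σ₀) ∧
      ∀ y : ComplexOfGroups.FundGroup 𝕐 (φ.f.onV σ₀),
        y ∈ φ.charSubgroup hφ σ₀ ↔ ∃ x : ComplexOfGroups.FundGroup 𝕏 σ₀, φ.inducedHom σ₀ x = y := by
  exact ⟨hφ.inducedHom_injective σ₀, fun _ => Iff.rfl⟩
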